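/- For $a\in\mathbb{N}$ put ${}^{0}a=1$ and ${}^{b+1}a=a^{({}^{b}a)}$. For $a\ge 2$ and $b\ge 0$ let $S(a,b)$ be the unique $n\ge 0$ with ${}^{b}a\equiv{}^{b+1}a \pmod{10^{n}}$ and ${}^{b}a\not\equiv{}^{b+1}a \pmod{10^{n+1}}$, and for $b\ge 1$ let $V(a,b)=S(a,b)-S(a,b-1)$ be the congruence speed of $a$ at height $b$. Let $\bar b(a)$ be the least $b\ge 1$ such that $V(a,b+k)=V(a,b)$ for all $k\ge 0$, and let $V(a)=V(a,\bar b(a))$ be the constant congruence speed of $a$. Let $$C=\{2,3,4,6,8,9,11,12,13,14,16,17,19,21,22,23\},$$ $$Q=\{1,57,68,124,126,182,193,249,318,374,376,432,568,624,626,682,751,807,818,874,876,932,943,999\}.$$ Then for every natural number $a\neq 1$ that is not divisible by $10$, a height $b\ge 1$ with $V(a,b+k)=V(a,b)$ for all $k\ge0$ exists (so $V(a)$ is well defined), and 1. $V(a)=1$ if and only if $a \bmod 25\in C$; 2. $V(a)=2$ if and only if $a\bmod 40\in\{5,35\}$, or $a \bmod 25\in\{1,7,18,24\}$ and $a\bmod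 1000\notin Q$; 3. $V(a)\ge 3$ if and only if $a \bmod 40\in\{15,25\}$ or $a\bmod 1000\in Q$. -/

import Mathlib

namespace TetrationSpeed

/-- The tetration `ᵇa`: `¹a = a` and `ᵇ⁺¹a = a ^ (ᵇa)`, with the usual convention `⁰a = 1`. -/
def tet (a : ℕ) : ℕ → ℕ
  | 0 => 1
  | b + 1 => a ^ tet a b

/-- The number of stable digits of `ᵇa`: the largest `n` with `ᵇa ≡ ᵇ⁺¹a (mod 10ⁿ)`.
For `2 ≤ a` it is the unique `n` with `ᵇa ≡ ᵇ⁺¹a (mod 10ⁿ)` and `ᵇa ≢ ᵇ⁺¹a (mod 10ⁿ⁺¹)`,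
see `stableDigits_eq_iff`. -/
noncomputable def stableDigits (a b : ℕ) : ℕ :=
  sSup {n : ℕ | tet a b ≡ tet a (b + 1) [MOD 10 ^ n]}

/-- The congruence speed `V(a, b)` at height `b ≥ 1`: the number of stable digits gained when
passing from height `b - 1` to height `b`. It is an integer, so that no truncation occurs. -/
noncomputable def congruenceSpeed (a b : ℕ) : ℤ :=
  (stableDigits a b : ℤ) - (stableDigits a (b - 1) : ℤ)

/-- The heights `b ≥ 1` from which on the congruence speed of `a` is constant. -/
def constantHeights (a : ℕ) : Set ℕ :=
  {b : ℕ | 1 ≤ b ∧ ∀ k : ℕ, congruenceSpeed a b = congruenceSpeed a (b + k)}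

/-- The least height from which on the congruence speed of `a` is constant. -/
noncomputable def optimalHeight (a : ℕ) : ℕ := sInf (constantHeights a)

/-- The constant congruence speed `V(a)`: the congruence speed of `a` at the least height from
which on it is constant. -/
noncomputable def constantSpeed (a : ℕ) : ℤ := congruenceSpeed a (optimalHeight a)

/-- The sixteen residues modulo `25`. -/
def residues25 : Finset ℕ := {2, 3, 4, 6, 8, 9, 11, 12, 13, 14, 16, 17, 19, 21, 22, 23}

/-- The twenty-four residues modulo `1000`. -/
def residues1000 : Finset ℕ :=
  {1, 57, 68, 124, 126, 182, 193, 249, 318, 374, 376, 432, 568,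
    624, 626, 682, 751, 807, 818, 874, 876, 932, 943, 999}

theorem tet_lt_tet_succ {a : ℕ} (ha : 2 ≤ a) (b : ℕ) : tet a b < tet a (b + 1) :=
  Nat.lt_pow_self ha

theorem stableDigits_eq_iff {a : ℕ} (ha : 2 ≤ a) (b n : ℕ) :
    stableDigits a b = n ↔
      tet a b ≡ tet a (b + 1) [MOD 10 ^ n] ∧ ¬ tet a b ≡ tet a (b + 1) [MOD 10 ^ (n + 1)] := by
  have hlt := tet_lt_tet_succ ha b
  have hbdd : BddAbove {n : ℕ | tet a b ≡ tet a (b + 1) [MOD 10 ^ n]} := by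
    refine ⟨tet a (b + 1), fun n hn => ?_⟩
    have hdvd := (Nat.modEq_iff_dvd' hlt.le).1 hn
    have h1 := Nat.le_of_dvd (Nat.sub_pos_of_lt hlt) hdvd
    have h2 : n < 10 ^ n := Nat.lt_pow_self (by norm_num)
    omega
  have hne : {n : ℕ | tet a b ≡ tet a (b + 1) [MOD 10 ^ n]}.Nonempty :=
    ⟨0, by simp [Nat.modEq_one]⟩
  have hmem : tet a b ≡ tet a (b + 1) [MOD 10 ^ stableDigits a b] := Nat.sSup_mem hne hbdd
  constructor
  · rintro rfl
    refine ⟨hmem, fun h => ?_⟩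
    have h3 : stableDigits a b + 1 ≤ stableDigits a b := le_csSup hbdd h
    omega
  · rintro ⟨h1, h2⟩
    have h3 : n ≤ stableDigits a b := le_csSup hbdd h1
    by_contra hn
    exact h2 (hmem.of_dvd (pow_dvd_pow 10 (by omega)))

end TetrationSpeed

namespace TetrationSpeed

/-! Write D_b for `tetDiff a b`. The number of stable digits is the smaller of the 2-adic and 5-adic
valuations of D_b, and D_{b+1} = a^(ᵇa) (a^(D_b) - 1). If p divides a, the first factor makes the
p-adic valuation grow at least like 2^b, so p eventually drops out of the minimum. Otherwise lifting
the exponent shows that each step eventually adds a constant: v_5(a^4 - 1) for p = 5 and v_2(a^2 -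
1) - 1 for p = 2. Hence V(a) is the smaller of the constants for those p in {2, 5} not dividing a.
Whether such a constant reaches 2 or 3 depends on a modulo small powers of p, and finite checks give
the residue lists. -/

/-- The difference between two consecutive tetrations. -/
def tetDiff (a b : ℕ) : ℕ := tet a (b + 1) - tet a b

theorem tetDiff_pos {a : ℕ} (ha : 2 ≤ a) (b : ℕ) : 0 < tetDiff a b :=
  Nat.sub_pos_of_lt (tet_lt_tet_succ ha b)

theorem tetDiff_succ {a : ℕ} (ha : 2 ≤ a) (b : ℕ) :
    tetDiff a (b + 1) = a ^ tet a b * (a ^ tetDiff a b - 1) := by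
  have h : tet a (b + 1) = tet a b + tetDiff a b := by
    have := tet_lt_tet_succ ha b
    unfold tetDiff; omega
  change a ^ tet a (b + 1) - a ^ tet a b = _
  rw [h, pow_add, Nat.mul_sub, mul_one]

theorem pow_sub_one_pos {a n : ℕ} (ha : 2 ≤ a) (hn : 0 < n) : 0 < a ^ n - 1 :=
  Nat.sub_pos_of_lt (Nat.one_lt_pow hn.ne' (by omega))

theorem stableDigits_eq_min {a : ℕ} (ha : 2 ≤ a) (b : ℕ) :
    stableDigits a b = min (padicValNat 2 (tetDiff a b)) (padicValNat 5 (tetDiff a b)) := by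
  have hle := (tet_lt_tet_succ ha b).le
  have hD := (tetDiff_pos ha b).ne'
  have : Fact (Nat.Prime 5) := ⟨by norm_num⟩
  have key : ∀ n, tet a b ≡ tet a (b + 1) [MOD 10 ^ n] ↔
      n ≤ padicValNat 2 (tetDiff a b) ∧ n ≤ padicValNat 5 (tetDiff a b) := by
    intro n
    rw [Nat.modEq_iff_dvd' hle, ← padicValNat_dvd_iff_le hD, ← padicValNat_dvd_iff_le hD,
      show (10 : ℕ) = 2 * 5 by norm_num, mul_pow]
    exact ⟨fun h => ⟨dvd_of_mul_right_dvd h, dvd_of_mul_left_dvd h⟩, fun h =>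
      (Nat.Coprime.pow n n (by norm_num : Nat.Coprime 2 5)).mul_dvd_of_dvd_of_dvd h.1 h.2⟩
  rw [stableDigits_eq_iff ha, key, key]
  omega

theorem two_pow_le_tet {a : ℕ} (ha : 2 ≤ a) (b : ℕ) : 2 ^ b ≤ tet a b := by
  induction b with
  | zero => simp [tet]
  | succ b ih =>
    calc 2 ^ (b + 1) ≤ 2 ^ tet a b :=
          Nat.pow_le_pow_right (by norm_num) (Nat.lt_two_pow_self.trans_le ih)
      _ ≤ a ^ tet a b := Nat.pow_le_pow_left ha _

theorem exists_linear_le_two_pow (K M : ℕ) : ∃ N, ∀ b, N ≤ b → K * b + M ≤ 2 ^ b := by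
  -- With L = 2K + M, 2^(2L) ≥ (L + 1)^2 ≥ 2KL + M; also b ≥ K, so doubling 2^b absorbs the
  -- increment K.
  refine ⟨(2 * K + M) + (2 * K + M), fun b hb => ?_⟩
  induction b, hb using Nat.le_induction with
  | base =>
    have h : 2 * K + M + 1 ≤ 2 ^ (2 * K + M) := Nat.lt_two_pow_self
    rw [pow_add]
    nlinarith [Nat.mul_le_mul h h]
  | succ b hb ih =>
    have h : K ≤ b := by omega
    have h2 : b < 2 ^ b := Nat.lt_two_pow_self
    rw [pow_succ]
    linarith

theorem eq_add_mul_of_step {f : ℕ → ℕ} {N p : ℕ} (h : ∀ b, N ≤ b → f (b + 1) = f b + p) (k : ℕ) :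
    f (N + k) = f N + p * k := by
  induction k with
  | zero => simp
  | succ k ih => rw [← add_assoc, h _ (by omega), ih]; ring

theorem eventually_min_step {f g : ℕ → ℕ} {N p q : ℕ}
    (hf : ∀ b, N ≤ b → f (b + 1) = f b + p) (hg : ∀ b, N ≤ b → g (b + 1) = g b + q) :
    ∃ B, ∀ b, B ≤ b → min (f (b + 1)) (g (b + 1)) = min (f b) (g b) + min p q := by
  -- Unequal slopes differ by at least 1, so `f N + g N` steps close any initial gap and the smaller
  -- slope governs the minimum.
  refine ⟨N + (f N + g N), fun b hb => ?_⟩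
  obtain ⟨k, rfl⟩ := Nat.exists_eq_add_of_le (show N ≤ b by omega)
  rw [hf _ (by omega), hg _ (by omega), eq_add_mul_of_step hf, eq_add_mul_of_step hg]
  have hk : f N + g N ≤ k := by omega
  rcases lt_trichotomy p q with h | h | h
  · have := Nat.mul_le_mul_right k (show p + 1 ≤ q from h)
    rw [add_mul, one_mul] at this
    omega
  · subst h; omega
  · have := Nat.mul_le_mul_right k (show q + 1 ≤ p from h)
    rw [add_mul, one_mul] at this
    omega

theorem eventually_min_step_of_two_pow_le {f g : ℕ → ℕ} {N q : ℕ}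
    (hf : ∀ b, 2 ^ b ≤ f (b + 1)) (hg : ∀ b, N ≤ b → g (b + 1) = g b + q) :
    ∃ B, ∀ b, B ≤ b → min (f (b + 1)) (g (b + 1)) = min (f b) (g b) + q := by
  obtain ⟨B, hB⟩ := exists_linear_le_two_pow q (g N + q)
  have hle : ∀ b, N + B ≤ b → g (b + 1) ≤ f (b + 1) := by
    intro b hb
    obtain ⟨k, rfl⟩ := Nat.exists_eq_add_of_le (show N ≤ b by omega)
    have h1 := hB (N + k) (by omega)
    have h2 := hf (N + k)
    rw [hg _ (by omega), eq_add_mul_of_step hg]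
    have h3 := Nat.mul_le_mul_left q (show k ≤ N + k by omega)
    omega
  -- The extra 1 makes the comparison `hle` available at both `b` and `b + 1`.
  refine ⟨N + B + 1, fun b hb => ?_⟩
  obtain ⟨c, rfl⟩ := Nat.exists_eq_add_of_le (show 1 ≤ b by omega)
  rw [add_comm 1 c, min_eq_right (hle (c + 1) (by omega)), min_eq_right (hle c (by omega)),
    hg _ (by omega)]

theorem constantSpeed_eq_of_eventually {a B c : ℕ}
    (h : ∀ b, B ≤ b → stableDigits a (b + 1) = stableDigits a b + c) :
    (constantHeights a).Nonempty ∧ constantSpeed a = c := by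
  have hspeed : ∀ b, B ≤ b → congruenceSpeed a (b + 1) = c := by
    intro b hb
    simp only [congruenceSpeed, Nat.add_sub_cancel, h b hb]
    push_cast; ring
  have hne : (constantHeights a).Nonempty := by
    refine ⟨B + 1, by omega, fun k => ?_⟩
    rw [hspeed B le_rfl, show B + 1 + k = B + k + 1 by ring, hspeed _ (by omega)]
  refine ⟨hne, ?_⟩
  have hmem : optimalHeight a ∈ constantHeights a := Nat.sInf_mem hne
  rw [constantSpeed, hmem.2 (B + 1), ← add_assoc, hspeed _ (by omega)]

theorem tet_even_four_dvd {a : ℕ} (ha : 2 ≤ a) (h2 : 2 ∣ a) {b : ℕ} (hb : 2 ≤ b) :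
    4 ∣ tet a b := by
  obtain ⟨c, rfl⟩ := Nat.exists_eq_add_of_le' hb
  have h : 2 ≤ tet a (c + 1) :=
    le_trans (by simpa using Nat.pow_le_pow_right (n := 2) (by norm_num) (show 1 ≤ c + 1 by omega))
      (two_pow_le_tet ha (c + 1))
  calc 4 = 2 ^ 2 := by norm_num
    _ ∣ a ^ 2 := pow_dvd_pow_of_dvd h2 2
    _ ∣ a ^ tet a (c + 1) := pow_dvd_pow a h

theorem two_dvd_tetDiff {a : ℕ} (ha : 2 ≤ a) (h2 : ¬ 2 ∣ a) (b : ℕ) : 2 ∣ tetDiff a b := by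
  have hodd : ∀ b, tet a b % 2 = 1 := by
    intro b
    cases b with
    | zero => rfl
    | succ b => exact Nat.odd_iff.1 (Odd.pow (Nat.odd_iff.2 (by omega)))
  have := hodd b
  have := hodd (b + 1)
  have := tet_lt_tet_succ ha b
  unfold tetDiff
  omega

/-- For odd a, the previous difference is even and odd squares are 1 mod 4. This lets a^(D_b) be
read as a power of a^4 in the 5-adic step. -/
theorem four_dvd_tetDiff {a : ℕ} (ha : 2 ≤ a) {b : ℕ} (hb : 2 ≤ b) : 4 ∣ tetDiff a b := by
  by_cases h2 : 2 ∣ a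
  · exact Nat.dvd_sub (tet_even_four_dvd ha h2 (by omega)) (tet_even_four_dvd ha h2 hb)
  · obtain ⟨c, rfl⟩ := Nat.exists_eq_add_of_le' (show 1 ≤ b by omega)
    rw [tetDiff_succ ha]
    obtain ⟨m, hm⟩ := two_dvd_tetDiff ha h2 c
    refine Dvd.dvd.mul_left ?_ _
    rw [hm, pow_mul]
    have h4 : a ^ 2 ≡ 1 [MOD 4] := by
      have : a % 4 = 1 ∨ a % 4 = 3 := by omega
      rcases this with h | h <;> simp [Nat.ModEq, Nat.pow_mod, h]
    have := h4.pow m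
    rw [one_pow] at this
    exact (Nat.modEq_iff_dvd' (Nat.one_le_pow _ _ (by positivity))).1 this.symm

theorem padicValNat_tetDiff_succ_of_not_dvd {p : ℕ} [hp : Fact p.Prime] {a : ℕ} (ha : 2 ≤ a)
    (h : ¬ p ∣ a) (b : ℕ) :
    padicValNat p (tetDiff a (b + 1)) = padicValNat p (a ^ tetDiff a b - 1) := by
  rw [tetDiff_succ ha, padicValNat.mul (by positivity) (pow_sub_one_pos ha (tetDiff_pos ha b)).ne',
    padicValNat.eq_zero_of_not_dvd (fun h' => h (hp.out.dvd_of_dvd_pow h')), zero_add]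

theorem two_pow_le_padicValNat_tetDiff {p : ℕ} [hp : Fact p.Prime] {a : ℕ} (ha : 2 ≤ a)
    (h : p ∣ a) (b : ℕ) : 2 ^ b ≤ padicValNat p (tetDiff a (b + 1)) := by
  refine (two_pow_le_tet ha b).trans ?_
  rw [← padicValNat_dvd_iff_le (tetDiff_pos ha _).ne', tetDiff_succ ha]
  exact (pow_dvd_pow_of_dvd h _).mul_right _

/-- Since a^4 ≡ 1 mod 5, lifting the exponent applies to (a^4)^m - 1 with D_b = 4m, and the factor 4
does not affect v_5. -/
theorem padicValNat_five_tetDiff_succ {a : ℕ} (ha : 2 ≤ a) (h5 : ¬ 5 ∣ a) {b : ℕ} (hb : 2 ≤ b) :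
    padicValNat 5 (tetDiff a (b + 1)) =
      padicValNat 5 (tetDiff a b) + padicValNat 5 (a ^ 4 - 1) := by
  have : Fact (Nat.Prime 5) := ⟨by norm_num⟩
  rw [padicValNat_tetDiff_succ_of_not_dvd ha h5]
  obtain ⟨m, hm⟩ := four_dvd_tetDiff ha hb
  have hm0 : m ≠ 0 := by
    rintro rfl
    exact (tetDiff_pos ha b).ne' hm
  have h1 : 5 ∣ a ^ 4 - 1 := by
    refine (Nat.modEq_iff_dvd' (Nat.one_le_pow _ _ (by omega))).1 ?_
    have : a % 5 = 1 ∨ a % 5 = 2 ∨ a % 5 = 3 ∨ a % 5 = 4 := by omega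
    rcases this with h | h | h | h <;> simp [Nat.ModEq, Nat.pow_mod, h]
  have h4 : ¬ 5 ∣ a ^ 4 := fun h => h5 ((by norm_num : Nat.Prime 5).dvd_of_dvd_pow h)
  have := padicValNat.pow_sub_pow (p := 5) (by decide) (x := a ^ 4) (y := 1)
    (Nat.one_lt_pow (by norm_num) (by omega)) h1 h4 hm0
  rw [one_pow, ← pow_mul] at this
  rw [hm, this, padicValNat.mul (by norm_num) hm0,
    padicValNat.eq_zero_of_not_dvd (by norm_num : ¬ 5 ∣ 4)]
  ring

/-- Lifting the exponent at 2 is applied to the even exponents D_b and 2; subtracting eliminates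
v_2(a - 1) + v_2(a + 1). -/
theorem padicValNat_two_tetDiff_succ {a : ℕ} (ha : 2 ≤ a) (h2 : ¬ 2 ∣ a) (b : ℕ) :
    padicValNat 2 (tetDiff a (b + 1)) + 1 =
      padicValNat 2 (tetDiff a b) + padicValNat 2 (a ^ 2 - 1) := by
  rw [padicValNat_tetDiff_succ_of_not_dvd ha h2]
  have h1 : 2 ∣ a - 1 := by omega
  have hD := padicValNat.pow_two_sub_pow (x := a) (y := 1) (by omega) h1 h2
    (tetDiff_pos ha b).ne' (even_iff_two_dvd.2 (two_dvd_tetDiff ha h2 b))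
  have hS := padicValNat.pow_two_sub_pow (x := a) (y := 1) (by omega) h1 h2
    (n := 2) (by norm_num) (by decide)
  rw [one_pow] at hD hS
  rw [padicValNat.self (by norm_num)] at hS
  omega

theorem le_padicValNat_pow_sub_one_iff {p : ℕ} [Fact p.Prime] {a n : ℕ} (ha : 2 ≤ a) (hn : 0 < n)
    (k : ℕ) : k ≤ padicValNat p (a ^ n - 1) ↔ (a % p ^ k) ^ n ≡ 1 [MOD p ^ k] := by
  rw [← padicValNat_dvd_iff_le (pow_sub_one_pos ha hn).ne',
    ← Nat.modEq_iff_dvd' (Nat.one_le_pow _ _ (by omega)), Nat.ModEq.comm]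
  exact ⟨((Nat.mod_modEq a _).pow n).trans, ((Nat.mod_modEq a _).pow n).symm.trans⟩

theorem le_padicValNat_sq_sub_one {a : ℕ} (ha : 2 ≤ a) (h2 : ¬ 2 ∣ a) :
    3 ≤ padicValNat 2 (a ^ 2 - 1) ∧
      (4 ≤ padicValNat 2 (a ^ 2 - 1) ↔ a % 8 = 1 ∨ a % 8 = 7) := by
  rw [le_padicValNat_pow_sub_one_iff ha (by norm_num), le_padicValNat_pow_sub_one_iff ha (by norm_num)]
  have key : ∀ r < 16, ¬ 2 ∣ r → (r % 8) ^ 2 ≡ 1 [MOD 8] ∧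
      (r ^ 2 ≡ 1 [MOD 16] ↔ r % 8 = 1 ∨ r % 8 = 7) := by decide
  have := key (a % 16) (Nat.mod_lt _ (by norm_num)) (by omega)
  rw [Nat.mod_mod_of_dvd a (by norm_num : 8 ∣ 16)] at this
  exact this

theorem constantSpeed_of_coprime {a : ℕ} (ha : 2 ≤ a) (h2 : ¬ 2 ∣ a) (h5 : ¬ 5 ∣ a) :
    (constantHeights a).Nonempty ∧ constantSpeed a =
      (min (padicValNat 2 (a ^ 2 - 1) - 1) (padicValNat 5 (a ^ 4 - 1)) : ℕ) := by
  have hp := (le_padicValNat_sq_sub_one ha h2).1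
  obtain ⟨B, hB⟩ := eventually_min_step (N := 2) (p := padicValNat 2 (a ^ 2 - 1) - 1)
    (f := fun b => padicValNat 2 (tetDiff a b)) (g := fun b => padicValNat 5 (tetDiff a b))
    (fun b _ => by have := padicValNat_two_tetDiff_succ ha h2 b; omega)
    (fun b hb => padicValNat_five_tetDiff_succ ha h5 hb)
  refine constantSpeed_eq_of_eventually (B := B) fun b hb => ?_
  rw [stableDigits_eq_min ha, stableDigits_eq_min ha]
  exact hB b hb

theorem constantSpeed_of_even {a : ℕ} (ha : 2 ≤ a) (h2 : 2 ∣ a) (h5 : ¬ 5 ∣ a) :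
    (constantHeights a).Nonempty ∧ constantSpeed a = (padicValNat 5 (a ^ 4 - 1) : ℕ) := by
  obtain ⟨B, hB⟩ := eventually_min_step_of_two_pow_le (N := 2)
    (f := fun b => padicValNat 2 (tetDiff a b)) (g := fun b => padicValNat 5 (tetDiff a b))
    (two_pow_le_padicValNat_tetDiff ha h2)
    (fun b hb => padicValNat_five_tetDiff_succ ha h5 hb)
  refine constantSpeed_eq_of_eventually (B := B) fun b hb => ?_
  rw [stableDigits_eq_min ha, stableDigits_eq_min ha]
  exact hB b hb

theorem constantSpeed_of_five_dvd {a : ℕ} (ha : 2 ≤ a) (h2 : ¬ 2 ∣ a) (h5 : 5 ∣ a) :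
    (constantHeights a).Nonempty ∧ constantSpeed a = (padicValNat 2 (a ^ 2 - 1) - 1 : ℕ) := by
  have : Fact (Nat.Prime 5) := ⟨by norm_num⟩
  have hp := (le_padicValNat_sq_sub_one ha h2).1
  obtain ⟨B, hB⟩ := eventually_min_step_of_two_pow_le (N := 0)
    (q := padicValNat 2 (a ^ 2 - 1) - 1)
    (f := fun b => padicValNat 5 (tetDiff a b)) (g := fun b => padicValNat 2 (tetDiff a b))
    (two_pow_le_padicValNat_tetDiff ha h5)
    (fun b _ => by have := padicValNat_two_tetDiff_succ ha h2 b; omega)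
  refine constantSpeed_eq_of_eventually (B := B) fun b hb => ?_
  rw [stableDigits_eq_min ha, stableDigits_eq_min ha, min_comm, min_comm (padicValNat 2 _)]
  exact hB b hb

theorem le_padicValNat_pow_four_sub_one {a : ℕ} (ha : 2 ≤ a) (h5 : ¬ 5 ∣ a) :
    1 ≤ padicValNat 5 (a ^ 4 - 1) ∧
      (2 ≤ padicValNat 5 (a ^ 4 - 1) ↔ a % 25 ∈ ({1, 7, 18, 24} : Finset ℕ)) ∧
      (3 ≤ padicValNat 5 (a ^ 4 - 1) ↔ a % 125 ∈ ({1, 57, 68, 124} : Finset ℕ)) := by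
  have : Fact (Nat.Prime 5) := ⟨by norm_num⟩
  simp only [le_padicValNat_pow_sub_one_iff ha (show 0 < 4 by norm_num)]
  have k5 : ∀ r < 5, r ≠ 0 → r ^ 4 ≡ 1 [MOD 5] := by decide
  have k25 : ∀ r < 25, (r ^ 4 ≡ 1 [MOD 25] ↔ r ∈ ({1, 7, 18, 24} : Finset ℕ)) := by decide
  have k125 : ∀ r < 125, (r ^ 4 ≡ 1 [MOD 125] ↔ r ∈ ({1, 57, 68, 124} : Finset ℕ)) := by
    decide
  exact ⟨k5 _ (Nat.mod_lt _ (by norm_num)) (by omega), k25 _ (Nat.mod_lt _ (by norm_num)),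
    k125 _ (Nat.mod_lt _ (by norm_num))⟩

theorem mem_residues25_iff (a : ℕ) :
    a % 25 ∈ residues25 ↔ ¬ 5 ∣ a ∧ a % 25 ∉ ({1, 7, 18, 24} : Finset ℕ) := by
  have key : ∀ r < 25, (r ∈ residues25 ↔ ¬ 5 ∣ r ∧ r ∉ ({1, 7, 18, 24} : Finset ℕ)) := by
    decide
  rw [key _ (Nat.mod_lt _ (by norm_num)), Nat.dvd_mod_iff (by norm_num : 5 ∣ 25)]

/-- By the Chinese remainder theorem, the list combines v_5(a^4 - 1) ≥ 3, seen mod 125, with a even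
or v_2(a^2 - 1) ≥ 4, seen mod 8. -/
theorem mem_residues1000_iff {a : ℕ} (h10 : ¬ 10 ∣ a) :
    a % 1000 ∈ residues1000 ↔
      a % 125 ∈ ({1, 57, 68, 124} : Finset ℕ) ∧ (2 ∣ a ∨ a % 8 = 1 ∨ a % 8 = 7) := by
  have key : ∀ r < 1000, ¬ 10 ∣ r → (r ∈ residues1000 ↔
      r % 125 ∈ ({1, 57, 68, 124} : Finset ℕ) ∧ (2 ∣ r ∨ r % 8 = 1 ∨ r % 8 = 7)) := by
    decide +kernel
  have := key (a % 1000) (Nat.mod_lt _ (by norm_num)) (by omega)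
  rwa [Nat.mod_mod_of_dvd a (by norm_num : 125 ∣ 1000),
    Nat.mod_mod_of_dvd a (by norm_num : 8 ∣ 1000), Nat.dvd_mod_iff (by norm_num : 2 ∣ 1000)] at this

end TetrationSpeed

theorem mainTheorem8 (a : ℕ) (ha1 : a ≠ 1) (ha10 : ¬ 10 ∣ a) :
    (TetrationSpeed.constantHeights a).Nonempty ∧
    (TetrationSpeed.constantSpeed a = 1 ↔ a % 25 ∈ TetrationSpeed.residues25) ∧
    (TetrationSpeed.constantSpeed a = 2 ↔
      (a % 40 = 5 ∨ a % 40 = 35) ∨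
        (a % 25 ∈ ({1, 7, 18, 24} : Finset ℕ) ∧ a % 1000 ∉ TetrationSpeed.residues1000)) ∧
    (3 ≤ TetrationSpeed.constantSpeed a ↔
      (a % 40 = 15 ∨ a % 40 = 25) ∨ a % 1000 ∈ TetrationSpeed.residues1000) := by
  have ha : 2 ≤ a := by
    rcases Nat.eq_zero_or_pos a with rfl | h
    · exact absurd (dvd_zero 10) ha10
    · omega
  rw [TetrationSpeed.mem_residues25_iff, TetrationSpeed.mem_residues1000_iff ha10]
  by_cases h5 : 5 ∣ a
  · have h2 : ¬ 2 ∣ a := by omega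
    obtain ⟨hne, hV⟩ := TetrationSpeed.constantSpeed_of_five_dvd ha h2 h5
    obtain ⟨hp, hp'⟩ := TetrationSpeed.le_padicValNat_sq_sub_one ha h2
    refine ⟨hne, ?_⟩
    rw [hV]
    simp only [Finset.mem_insert, Finset.mem_singleton]
    -- No residue listed mod 25 or mod 125 is a multiple of 5, so only the conditions mod 40
    -- survive.
    have h25 : a % 25 % 5 = 0 := by omega
    have h125 : a % 125 % 5 = 0 := by omega
    have h8 : a % 8 = a % 40 % 8 := by omega
    have h40 : a % 40 = 5 ∨ a % 40 = 15 ∨ a % 40 = 25 ∨ a % 40 = 35 := by omega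
    rcases h40 with h | h | h | h <;> rw [h8, h] at hp' <;> rw [h] <;> omega
  · obtain ⟨hq1, hq2, hq3⟩ := TetrationSpeed.le_padicValNat_pow_four_sub_one ha h5
    by_cases h2 : 2 ∣ a
    · obtain ⟨hne, hV⟩ := TetrationSpeed.constantSpeed_of_even ha h2 h5
      refine ⟨hne, ?_⟩
      rw [hV, ← hq2, ← hq3]
      omega
    · obtain ⟨hne, hV⟩ := TetrationSpeed.constantSpeed_of_coprime ha h2 h5
      obtain ⟨hp, hp'⟩ := TetrationSpeed.le_padicValNat_sq_sub_one ha h2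
      refine ⟨hne, ?_⟩
      rw [hV, ← hq2, ← hq3]
      omega
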